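/- Let $R$ be an associative ring with unit (not necessarily commutative) and let $W$ be a left $R$-module. A submodule $K$ of a left $R$-module $L$ is called *pure* if for every right $R$-module $N$ the canonical map $N\otimes_R K\to N\otimes_R L$ is injective. A left $R$-module $W$ is called *locally projective* if for every surjective $R$-linear map $\pi:L\to N$ of left $R$-modules, every $R$-linear map $g:W\to N$ and every finitely generated submodule $F\subset W$ there is an $R$-linear map $g':W\to L$ with $\pi\circ g'|_F=g|_F$. The module ${}_RR$ is called *$W$-injective* if for every submodule $K\subset W$ every $R$-linear map $K\to R$ extends to an $R$-linear map $W\to R$. Write ${}^*W=\mathrm{Hom}_R(W,R)$ for the set of left $R$-linear maps $W\to R$, and let $\chi:W\to R^{{}^*W}$ be the canonical $R$-linear map $w\mapsto(f\mapsto f(w))$. 1. If $W$ is locally projective, then every pure submodule $K\subset W$ is locally projective. If ${}_RR$ is $W$-injective, then every locally projective submodule of $W$ (where $W$ itself need not be locally projective) is a pure submodule of $W$. 2. Assume that $R$ is right Noetherian. Then $W$ is locally projective if and only if $W\subset R^{{}^*W}$ is a pure $R$-submodule, that is, if and only if $\chi$ is injective and $\chi(W)$ is a pure submodule of $R^{{}^*W}$.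 -/

import Mathlib

open scoped TensorProduct

universe u v w

namespace PureModules

/-- The subgroup of `N ⊗[ℤ] W` generated by the elements `(n r) ⊗ w - n ⊗ (r w)`,
for a right `R`-module `N` and a left `R`-module `W`. -/
def balancedRelations (R : Type u) [Ring R] (N : Type w) [AddCommGroup N] [Module Rᵐᵒᵖ N]
    (W : Type v) [AddCommGroup W] [Module R W] : Submodule ℤ (N ⊗[ℤ] W) :=
  Submodule.span ℤ
    {t | ∃ (n : N) (r : R) (x : W), t = (MulOpposite.op r • n) ⊗ₜ[ℤ] x - n ⊗ₜ[ℤ] (r • x)}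

/-- The tensor product `N ⊗_R W` of a right `R`-module `N` and a left `R`-module `W` over a
not necessarily commutative ring `R`, as an abelian group. -/
abbrev BalancedTensor (R : Type u) [Ring R] (N : Type w) [AddCommGroup N] [Module Rᵐᵒᵖ N]
    (W : Type v) [AddCommGroup W] [Module R W] : Type (max v w) :=
  (N ⊗[ℤ] W) ⧸ balancedRelations R N W

theorem balancedRelations_le_comap {R : Type u} [Ring R] (N : Type w) [AddCommGroup N]
    [Module Rᵐᵒᵖ N] {K L : Type v} [AddCommGroup K] [Module R K] [AddCommGroup L] [Module R L]
    (f : K →ₗ[R] L) :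
    balancedRelations R N K ≤
      (balancedRelations R N L).comap (LinearMap.lTensor N (f.restrictScalars ℤ)) := by
  refine Submodule.span_le.2 ?_
  rintro _ ⟨n, r, x, rfl⟩
  exact Submodule.subset_span ⟨n, r, f x, by simp⟩

/-- The homomorphism `id_N ⊗ f : N ⊗_R K → N ⊗_R L`. -/
def BalancedTensor.map {R : Type u} [Ring R] (N : Type w) [AddCommGroup N]
    [Module Rᵐᵒᵖ N] {K L : Type v} [AddCommGroup K] [Module R K] [AddCommGroup L] [Module R L]
    (f : K →ₗ[R] L) : BalancedTensor R N K →ₗ[ℤ] BalancedTensor R N L :=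
  Submodule.mapQ _ _ (LinearMap.lTensor N (f.restrictScalars ℤ)) (balancedRelations_le_comap N f)

/-- A submodule `K` of the left `R`-module `L` is pure (in the sense of Cohn) if
`N ⊗_R K → N ⊗_R L` is injective for every right `R`-module `N`. -/
def IsPure {R : Type u} [Ring R] {L : Type v} [AddCommGroup L] [Module R L]
    (K : Submodule R L) : Prop :=
  ∀ (N : Type (max u v)) [AddCommGroup N] [Module Rᵐᵒᵖ N],
    Function.Injective (BalancedTensor.map N K.subtype)

/-- `W` is locally projective: for every surjection `π : L → N`, every `g : W → N` and every
finitely generated submodule `F` of `W` there is `g' : W → L` with `π ∘ g' = g` on `F`. -/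
def IsLocallyProjective (R : Type u) [Ring R] (W : Type v) [AddCommGroup W] [Module R W] : Prop :=
  ∀ (L N : Type (max u v)) [AddCommGroup L] [Module R L] [AddCommGroup N] [Module R N]
    (π : L →ₗ[R] N) (g : W →ₗ[R] N) (F : Submodule R W),
    Function.Surjective π → F.FG →
      ∃ g' : W →ₗ[R] L, (π ∘ₗ g') ∘ₗ F.subtype = g ∘ₗ F.subtype

/-- `U` is `W`-injective: every linear map from a submodule of `W` to `U` extends to `W`. -/
def IsRelInjective (R : Type u) [Ring R] (U : Type w) [AddCommGroup U] [Module R U]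
    (W : Type v) [AddCommGroup W] [Module R W] : Prop :=
  ∀ (K : Submodule R W) (f : K →ₗ[R] U), ∃ g : W →ₗ[R] U, g ∘ₗ K.subtype = f

/-- The canonical map `W → R^{*W}`, `x ↦ (φ ↦ φ x)`, where `*W = Hom_R(W, R)`. -/
def evalMap (R : Type u) [Ring R] (W : Type v) [AddCommGroup W] [Module R W] :
    W →ₗ[R] ((W →ₗ[R] R) → R) :=
  LinearMap.pi fun φ => φ

end PureModules

namespace PureModules

section

variable {R : Type u} [Ring R]

/-! Local projectivity amounts to local dual bases: `x = ∑ φⱼ(x) wⱼ` for each `x`. For `x` in a pure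
submodule `K`, read this as a linear equation in the `wⱼ` with coefficients `φⱼ(x)`; purity solves
it inside `K` (`IsPure.exists_sum_smul_eq`), so `K` inherits the property. Conversely, local dual
bases on `K` give finite rank endomorphisms fixing any finite subset. If functionals on `K` extend
to the ambient module, so do these endomorphisms, and the resulting local retractions force purity.
For the last part, functionals on `χ(W)` always extend, and over a right Noetherian ring every power
of `R` has local dual bases. -/

/-- Every element `x` of `W` has a finite expansion `x = ∑ φⱼ(x) wⱼ` with `φⱼ ∈ *W`, `wⱼ ∈ W`. -/
def HasLocalDualBases (R : Type u) [Ring R] (W : Type v) [AddCommGroup W] [Module R W] : Prop :=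
  ∀ x : W, ∃ (n : ℕ) (φ : Fin n → W →ₗ[R] R) (w : Fin n → W), ∑ j, φ j x • w j = x

/-- The endomorphisms of the form `x ↦ ∑ φⱼ(x) wⱼ`. -/
def finiteRankEnd (R : Type u) [Ring R] (W : Type v) [AddCommGroup W] [Module R W] :
    AddSubgroup (W →ₗ[R] W) :=
  AddSubgroup.closure {e | ∃ (φ : W →ₗ[R] R) (w : W), e = φ.smulRight w}

variable {W : Type v} [AddCommGroup W] [Module R W]

/-! ### Finite rank endomorphisms and local projectivity -/

theorem smulRight_mem_finiteRankEnd (φ : W →ₗ[R] R) (w : W) :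
    φ.smulRight w ∈ finiteRankEnd R W :=
  AddSubgroup.subset_closure ⟨φ, w, rfl⟩

theorem comp_mem_finiteRankEnd {e : W →ₗ[R] W} (he : e ∈ finiteRankEnd R W) (f : W →ₗ[R] W) :
    e ∘ₗ f ∈ finiteRankEnd R W := by
  induction he using AddSubgroup.closure_induction with
  | mem _ h =>
    obtain ⟨φ, w, rfl⟩ := h
    exact smulRight_mem_finiteRankEnd (φ ∘ₗ f) w
  | zero => rw [LinearMap.zero_comp]; exact zero_mem _
  | add _ _ _ _ h₁ h₂ => rw [LinearMap.add_comp]; exact add_mem h₁ h₂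
  | neg _ _ h => rw [LinearMap.neg_comp]; exact neg_mem h

theorem HasLocalDualBases.exists_fix (h : HasLocalDualBases R W) (s : Finset W) :
    ∃ e ∈ finiteRankEnd R W, ∀ x ∈ s, e x = x := by
  classical
  induction s using Finset.induction_on with
  | empty => exact ⟨0, zero_mem _, by simp⟩
  | insert a s _ ih =>
    obtain ⟨e, he, hes⟩ := ih
    obtain ⟨n, φ, w, hw⟩ := h (a - e a)
    set e' : W →ₗ[R] W := ∑ j, (φ j).smulRight (w j) with he'
    have he'_mem : e' ∈ finiteRankEnd R W :=
      sum_mem fun j _ => smulRight_mem_finiteRankEnd _ _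
    have he'_a : e' (a - e a) = a - e a := by
      simpa [he', LinearMap.sum_apply] using hw
    -- `1 - (e + e'(1 - e)) = (1 - e')(1 - e)`: the right factor kills `s`, and the left one kills
    -- `a - e a`.
    refine ⟨e + e' ∘ₗ (LinearMap.id - e), add_mem he (comp_mem_finiteRankEnd he'_mem _), ?_⟩
    intro x hx
    rcases Finset.mem_insert.1 hx with rfl | hx
    · simp only [LinearMap.add_apply, LinearMap.comp_apply, LinearMap.sub_apply,
        LinearMap.id_apply, he'_a]
      abel
    · simp [hes x hx]

theorem finiteRankEnd.exists_lift {L N : Type*} [AddCommGroup L] [Module R L] [AddCommGroup N]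
    [Module R N] {π : L →ₗ[R] N} (hπ : Function.Surjective π) (g : W →ₗ[R] N)
    {e : W →ₗ[R] W} (he : e ∈ finiteRankEnd R W) : ∃ g' : W →ₗ[R] L, π ∘ₗ g' = g ∘ₗ e := by
  induction he using AddSubgroup.closure_induction with
  | mem _ h =>
    obtain ⟨φ, w, rfl⟩ := h
    obtain ⟨l, hl⟩ := hπ (g w)
    exact ⟨φ.smulRight l, by ext x; simp [hl]⟩
  | zero => exact ⟨0, by simp⟩
  | add _ _ _ _ h₁ h₂ =>
    obtain ⟨g₁, h₁⟩ := h₁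
    obtain ⟨g₂, h₂⟩ := h₂
    exact ⟨g₁ + g₂, by simp [LinearMap.comp_add, h₁, h₂]⟩
  | neg _ _ h =>
    obtain ⟨g', h⟩ := h
    exact ⟨-g', by simp [LinearMap.comp_neg, h]⟩

/-- If all functionals on `W` extend along `i : W → L`, so do all finite rank endomorphisms. -/
theorem finiteRankEnd.exists_extension {L : Type*} [AddCommGroup L] [Module R L] (i : W →ₗ[R] L)
    (hi : ∀ φ : W →ₗ[R] R, ∃ ψ : L →ₗ[R] R, ψ ∘ₗ i = φ)
    {e : W →ₗ[R] W} (he : e ∈ finiteRankEnd R W) : ∃ g : L →ₗ[R] W, g ∘ₗ i = e := by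
  induction he using AddSubgroup.closure_induction with
  | mem _ h =>
    obtain ⟨φ, w, rfl⟩ := h
    obtain ⟨ψ, rfl⟩ := hi φ
    exact ⟨ψ.smulRight w, by ext x; simp⟩
  | zero => exact ⟨0, by simp⟩
  | add _ _ _ _ h₁ h₂ =>
    obtain ⟨g₁, h₁⟩ := h₁
    obtain ⟨g₂, h₂⟩ := h₂
    exact ⟨g₁ + g₂, by simp [LinearMap.add_comp, h₁, h₂]⟩
  | neg _ _ h =>
    obtain ⟨g', h⟩ := h
    exact ⟨-g', by simp [LinearMap.neg_comp, h]⟩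

theorem isLocallyProjective_iff_hasLocalDualBases :
    IsLocallyProjective R W ↔ HasLocalDualBases R W := by
  constructor
  · intro h x
    -- Lift the identity, on the span of `x`, to the free module on the set `W`; the coordinates of
    -- the lift are the `φⱼ`. `ULift` only adjusts the universe.
    let π : (W →₀ R) →ₗ[R] ULift.{u} W :=
      ULift.moduleEquiv.symm.toLinearMap ∘ₗ Finsupp.linearCombination R id
    have hπ : Function.Surjective π := fun y =>
      ⟨Finsupp.single y.down 1, by simp [π]⟩
    obtain ⟨g', hg'⟩ := h (W →₀ R) (ULift.{u} W) π ULift.moduleEquiv.symm.toLinearMap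
      (Submodule.span R {x}) hπ (Submodule.fg_span_singleton x)
    have hx : Finsupp.linearCombination R id (g' x) = x := by
      have := LinearMap.congr_fun hg' ⟨x, Submodule.mem_span_singleton_self x⟩
      simpa [π] using this
    let b := (g' x).support.equivFin
    refine ⟨_, fun j => Finsupp.lapply (b.symm j : W) ∘ₗ g', fun j => (b.symm j : W), ?_⟩
    rw [b.symm.sum_comp fun y : (g' x).support => (Finsupp.lapply (y : W) ∘ₗ g') x • (y : W)]
    refine Eq.trans ?_ hx
    rw [Finsupp.linearCombination_apply, Finsupp.sum]
    exact Finset.sum_coe_sort (g' x).support fun y => (g' x) y • y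
  · intro h L N _ _ _ _ π g F hπ hF
    obtain ⟨s, rfl⟩ := hF
    obtain ⟨e, he, hes⟩ := h.exists_fix s
    obtain ⟨g', hg'⟩ := finiteRankEnd.exists_lift hπ g he
    refine ⟨g', ?_⟩
    ext ⟨x, hx⟩
    have hex : e x = x := LinearMap.eqOn_span (g := LinearMap.id) hes hx
    have := LinearMap.congr_fun hg' x
    simpa [hex] using this

theorem HasLocalDualBases.of_linearEquiv {W' : Type*} [AddCommGroup W'] [Module R W']
    (h : HasLocalDualBases R W) (f : W ≃ₗ[R] W') : HasLocalDualBases R W' := by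
  intro x
  obtain ⟨n, φ, w, hx⟩ := h (f.symm x)
  refine ⟨n, fun j => φ j ∘ₗ f.symm.toLinearMap, fun j => f (w j), ?_⟩
  simpa using congrArg f hx

/-! ### Balanced tensors and local retractions -/

namespace BalancedTensor

variable {N : Type w} [AddCommGroup N] [Module Rᵐᵒᵖ N]

/-- The pure tensor `n ⊗ x` of the balanced tensor product. -/
def tmul (R : Type u) [Ring R] {N : Type w} [AddCommGroup N] [Module Rᵐᵒᵖ N]
    {W : Type v} [AddCommGroup W] [Module R W] (n : N) (x : W) : BalancedTensor R N W :=
  (balancedRelations R N W).mkQ (n ⊗ₜ[ℤ] x)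

theorem map_tmul {K L : Type v} [AddCommGroup K] [Module R K] [AddCommGroup L] [Module R L]
    (f : K →ₗ[R] L) (n : N) (x : K) : map N f (tmul R n x) = tmul R n (f x) := rfl

theorem tmul_smul (n : N) (r : R) (x : W) :
    tmul R n (r • x) = tmul R (MulOpposite.op r • n) x :=
  ((Submodule.Quotient.eq (balancedRelations R N W)).2 (Submodule.subset_span ⟨n, r, x, rfl⟩)).symm

theorem zero_tmul (x : W) : tmul R (0 : N) x = 0 := by
  rw [tmul, TensorProduct.zero_tmul, map_zero]

theorem tmul_sum {ι : Type*} (s : Finset ι) (n : N) (x : ι → W) :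
    tmul R n (∑ i ∈ s, x i) = ∑ i ∈ s, tmul R n (x i) := by
  simp only [tmul, TensorProduct.tmul_sum, map_sum]

theorem exists_eq_sum_tmul (t : BalancedTensor R N W) :
    ∃ s : Finset (N × W), t = ∑ p ∈ s, tmul R p.1 p.2 := by
  obtain ⟨t, rfl⟩ := Submodule.mkQ_surjective _ t
  obtain ⟨s, rfl⟩ := TensorProduct.exists_finset t
  exact ⟨s, by simp only [map_sum, tmul]⟩

end BalancedTensor

/-- A submodule is pure as soon as each of its finite subsets is fixed by a linear map from the
whole module to the submodule. -/
theorem isPure_of_exists_local_retraction {L : Type v} [AddCommGroup L] [Module R L]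
    {K : Submodule R L}
    (h : ∀ s : Finset K, ∃ g : L →ₗ[R] K, ∀ x ∈ s, g x = x) : IsPure K := by
  classical
  intro N _ _
  rw [injective_iff_map_eq_zero]
  intro t ht
  obtain ⟨s, rfl⟩ := BalancedTensor.exists_eq_sum_tmul t
  obtain ⟨g, hg⟩ := h (s.image Prod.snd)
  have := congrArg (BalancedTensor.map N g) ht
  simp only [map_sum, BalancedTensor.map_tmul, map_zero, Submodule.subtype_apply] at this
  rw [← this]
  refine Finset.sum_congr rfl fun p hp => ?_
  rw [hg _ (Finset.mem_image_of_mem _ hp)]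

theorem HasLocalDualBases.isPure {L : Type v} [AddCommGroup L] [Module R L]
    {K : Submodule R L} (h : HasLocalDualBases R K)
    (hK : ∀ φ : K →ₗ[R] R, ∃ ψ : L →ₗ[R] R, ψ ∘ₗ K.subtype = φ) : IsPure K := by
  refine isPure_of_exists_local_retraction fun s => ?_
  obtain ⟨e, he, hes⟩ := h.exists_fix s
  obtain ⟨g, rfl⟩ := finiteRankEnd.exists_extension K.subtype hK he
  exact ⟨g, hes⟩

/-! ### Linear equations in pure submodules -/

section

variable {ι : Type*} [Fintype ι] (a : ι → R) (K : Type v) [AddCommGroup K] [Module R K]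

/-- The additive map `(kⱼ)ⱼ ↦ ∑ aⱼ kⱼ`. -/
def linearForm : (ι → K) →ₗ[ℤ] K :=
  ∑ j, (Module.toAddMonoidEnd R K (a j)).toIntLinearMap ∘ₗ LinearMap.proj j

theorem linearForm_apply (k : ι → K) : linearForm a K k = ∑ j, a j • k j := by
  simp only [linearForm, LinearMap.sum_apply]
  rfl

/-- The additive map sending `r` to multiplication by `r` from `K` to `K / ∑ aⱼ K`. -/
def mulModLinearForm : R →ₗ[ℤ] K →ₗ[ℤ] K ⧸ LinearMap.range (linearForm a K) :=
  (AddMonoidHom.mk' (fun r => (LinearMap.range (linearForm a K)).mkQ ∘ₗ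
      (Module.toAddMonoidEnd R K r).toIntLinearMap)
    (fun r s => LinearMap.ext fun k =>
      congrArg (LinearMap.range (linearForm a K)).mkQ (add_smul r s k))).toIntLinearMap

theorem mulModLinearForm_apply (r : R) (k : K) :
    mulModLinearForm a K r k = (LinearMap.range (linearForm a K)).mkQ (r • k) := rfl

/-- Since `(aⱼ c) k = aⱼ (c k)`, the right ideal generated by the `aⱼ` maps `K` into `∑ aⱼ K`, which
is in general only an additive subgroup. -/
theorem span_le_ker_mulModLinearForm :
    (Submodule.span Rᵐᵒᵖ (Set.range a)).restrictScalars ℤ ≤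
      LinearMap.ker (mulModLinearForm a K) := by
  classical
  intro r hr
  rw [Submodule.restrictScalars_mem, Submodule.mem_span_range_iff_exists_fun] at hr
  obtain ⟨c, rfl⟩ := hr
  rw [LinearMap.mem_ker]
  ext k
  rw [mulModLinearForm_apply, LinearMap.zero_apply, Submodule.mkQ_apply,
    Submodule.Quotient.mk_eq_zero]
  refine ⟨fun j => (c j).unop • k, ?_⟩
  rw [linearForm_apply, Finset.sum_smul]
  exact Finset.sum_congr rfl fun j _ => by rw [← mul_smul]; rfl

end

/-- A linear equation with constant term in a pure submodule that is solvable in the whole module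
is solvable in the submodule. -/
theorem IsPure.exists_sum_smul_eq {L : Type v} [AddCommGroup L] [Module R L]
    {K : Submodule R L} (hK : IsPure K) {ι : Type*} [Fintype ι] (a : ι → R) (l : ι → L) (x : K)
    (hx : ∑ j, a j • l j = x) : ∃ k : ι → K, ∑ j, a j • k j = x := by
  -- Test purity on `R ⧸ I`: `1 ⊗ x` vanishes over `L`, hence over `K`, and `r ⊗ k ↦ r k` (the map
  -- `γ`) sends it to the class of `x` in `K / ∑ aⱼ K`.
  let I : Submodule Rᵐᵒᵖ R := Submodule.span Rᵐᵒᵖ (Set.range a)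
  let one : ULift.{v} (R ⧸ I) := ⟨I.mkQ 1⟩
  have hzero (j : ι) : MulOpposite.op (a j) • one = 0 := by
    have : I.mkQ (MulOpposite.op (a j) • (1 : R)) = 0 := by
      rw [Submodule.mkQ_apply, Submodule.Quotient.mk_eq_zero, op_smul_eq_mul, one_mul]
      exact Submodule.subset_span ⟨j, rfl⟩
    exact ULift.ext _ _ this
  have htmul : BalancedTensor.tmul R one x = 0 := by
    refine (injective_iff_map_eq_zero _).1 (hK (ULift.{v} (R ⧸ I))) _ ?_
    rw [BalancedTensor.map_tmul, Submodule.subtype_apply, ← hx, BalancedTensor.tmul_sum]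
    refine Finset.sum_eq_zero fun j _ => ?_
    rw [BalancedTensor.tmul_smul, hzero, BalancedTensor.zero_tmul]
  let β : (R ⧸ I) →ₗ[ℤ] K →ₗ[ℤ] K ⧸ LinearMap.range (linearForm a K) :=
    (I.restrictScalars ℤ).liftQ (mulModLinearForm a K) (span_le_ker_mulModLinearForm a K) ∘ₗ
      (Submodule.Quotient.restrictScalarsEquiv ℤ I).symm.toLinearMap
  have hβ (r : R) (k : K) :
      β (I.mkQ r) k = (LinearMap.range (linearForm a K)).mkQ (r • k) := rfl
  let γ : ULift.{v} (R ⧸ I) ⊗[ℤ] K →ₗ[ℤ] K ⧸ LinearMap.range (linearForm a K) :=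
    TensorProduct.lift (β ∘ₗ ULift.moduleEquiv.toLinearMap)
  have hγ : balancedRelations R (ULift.{v} (R ⧸ I)) K ≤ LinearMap.ker γ := by
    refine Submodule.span_le.2 ?_
    rintro _ ⟨⟨n⟩, r, k, rfl⟩
    obtain ⟨s, rfl⟩ := I.mkQ_surjective n
    have h₁ : γ ((MulOpposite.op r • (⟨I.mkQ s⟩ : ULift.{v} (R ⧸ I))) ⊗ₜ[ℤ] k) =
        β (I.mkQ (s * r)) k := rfl
    have h₂ : γ ((⟨I.mkQ s⟩ : ULift.{v} (R ⧸ I)) ⊗ₜ[ℤ] (r • k)) = β (I.mkQ s) (r • k) := rfl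
    rw [SetLike.mem_coe, LinearMap.mem_ker, map_sub, h₁, h₂, hβ, hβ, mul_smul, sub_self]
  have hmem : β (I.mkQ 1) x = 0 :=
    hγ ((Submodule.Quotient.mk_eq_zero _).1 htmul)
  rw [hβ, one_smul, Submodule.mkQ_apply, Submodule.Quotient.mk_eq_zero] at hmem
  obtain ⟨k, hk⟩ := hmem
  exact ⟨k, by rw [← hk, linearForm_apply]⟩

/-! ### Pure submodules, powers of `R` and the evaluation map -/

theorem HasLocalDualBases.of_isPure (h : HasLocalDualBases R W) {K : Submodule R W}
    (hK : IsPure K) : HasLocalDualBases R K := by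
  intro x
  obtain ⟨n, φ, w, hw⟩ := h x
  obtain ⟨k, hk⟩ := hK.exists_sum_smul_eq (fun j => φ j x) w x hw
  exact ⟨n, fun j => φ j ∘ₗ K.subtype, k, hk⟩

/-- The right ideal generated by the coordinates of `x` is generated by finitely many of them, so `x
k = ∑ x(i_y) c(k, y)`: the functionals are projections and the vectors are `c(·, y)`. -/
theorem hasLocalDualBases_pi [IsNoetherian Rᵐᵒᵖ R] (I : Type*) :
    HasLocalDualBases R (I → R) := by
  classical
  intro x
  obtain ⟨t, ht, hspan⟩ := Submodule.fg_span_iff_fg_span_finset_subset (Set.range x) |>.1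
    (IsNoetherian.noetherian (Submodule.span Rᵐᵒᵖ (Set.range x)))
  have hsub (y : t) : ∃ i, x i = y := ht y.2
  choose i hi using hsub
  have hx (k : I) : ∃ c : t → Rᵐᵒᵖ, ∑ y, c y • (y : R) = x k := by
    have hk : x k ∈ Submodule.span Rᵐᵒᵖ (Set.range x) := Submodule.subset_span ⟨k, rfl⟩
    rw [hspan] at hk
    have hr : (t : Set R) = Set.range ((↑) : t → R) := by simp
    rwa [hr, Submodule.mem_span_range_iff_exists_fun] at hk
  choose c hc using hx
  let b := t.equivFin
  refine ⟨_, fun j => LinearMap.proj (i (b.symm j)), fun j k => (c k (b.symm j)).unop, ?_⟩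
  rw [b.symm.sum_comp fun y : t =>
    (LinearMap.proj (R := R) (φ := fun _ : I => R) (i y)) x • fun k => (c k y).unop]
  ext k
  rw [Finset.sum_apply, ← hc k]
  refine Finset.sum_congr rfl fun y _ => ?_
  rw [Pi.smul_apply, LinearMap.proj_apply, hi]
  rfl

theorem HasLocalDualBases.injective_evalMap (h : HasLocalDualBases R W) :
    Function.Injective (evalMap R W) := by
  rw [injective_iff_map_eq_zero]
  intro x hx
  obtain ⟨n, φ, w, hw⟩ := h x
  rw [← hw]
  refine Finset.sum_eq_zero fun j _ => ?_
  have : φ j x = 0 := congrFun hx (φ j)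
  rw [this, zero_smul]

/-- The composite of `φ` with `χ` is itself an index of the product, and the projection to that
coordinate extends `φ`. -/
theorem exists_extension_of_range_evalMap (h : Function.Injective (evalMap R W))
    (φ : LinearMap.range (evalMap R W) →ₗ[R] R) :
    ∃ ψ : ((W →ₗ[R] R) → R) →ₗ[R] R, ψ ∘ₗ (LinearMap.range (evalMap R W)).subtype = φ := by
  refine ⟨LinearMap.proj (φ ∘ₗ (LinearEquiv.ofInjective _ h).toLinearMap), ?_⟩
  ext ⟨_, x, rfl⟩
  rfl

end

end PureModules

open PureModules in
theorem mainTheorem9 {R : Type u} [Ring R] {W : Type v} [AddCommGroup W] [Module R W] :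
    (PureModules.IsLocallyProjective R W →
      ∀ K : Submodule R W, PureModules.IsPure K → PureModules.IsLocallyProjective R K) ∧
    (PureModules.IsRelInjective R R W →
      ∀ K : Submodule R W, PureModules.IsLocallyProjective R K → PureModules.IsPure K) ∧
    (IsNoetherian Rᵐᵒᵖ R →
      (PureModules.IsLocallyProjective R W ↔
        Function.Injective (PureModules.evalMap R W) ∧
          PureModules.IsPure (LinearMap.range (PureModules.evalMap R W)))) := by
  simp only [isLocallyProjective_iff_hasLocalDualBases]
  refine ⟨fun h K hK => h.of_isPure hK, fun h K hK => hK.isPure (h K), fun _ => ⟨fun h => ?_, ?_⟩⟩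
  · have hinj := h.injective_evalMap
    exact ⟨hinj, (h.of_linearEquiv (LinearEquiv.ofInjective _ hinj)).isPure
      (exists_extension_of_range_evalMap hinj)⟩
  · rintro ⟨hinj, hpure⟩
    exact ((hasLocalDualBases_pi _).of_isPure hpure).of_linearEquiv
      (LinearEquiv.ofInjective _ hinj).symm
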